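/- Let $H\in(1/2,1]$ and $\lambda,\sigma>0$. Let $(B_H(t))_{t\in\mathbb R}$ be a fractional Brownian motion with Hurst parameter $H$, i.e. an almost surely continuous centered Gaussian process with $\mathbb E(B_H(t)B_H(s))=\frac12\left(|t|^{2H}+|s|^{2H}-|t-s|^{2H}\right)$ for $s,t\in\mathbb R$, and let $(X_t)_{t\in\mathbb R}\sim\mathrm{FOU}(\lambda,\sigma,H)$ be the fractional Ornstein–Uhlenbeck process $$X_t=\sigma\int_{-\infty}^t e^{-\lambda(t-s)}\,dB_H(s)\quad\text{almost surely, for each } t\in\mathbb R,$$ where the integral is the pathwise improper Riemann–Stieltjes integral (the limit as $a\to-\infty$ of the Riemann–Stieltjes integrals over $[a,t]$). For $x\ge 0$ put $$f_H(x)=e^{-x}\left(\Gamma(2H)-\int_0^x e^{s}s^{2H-1}\,ds\right)+e^{x}\left(\Gamma(2H)-\int_0^x e^{-s}s^{2H-1}\,ds\right).$$ Then every $X_t$ is square integrable with mean zero, and for every $t\in\mathbb R$ $$\mathbb E(X_0X_t)=\frac{\sigma^2 H\,f_H(\lambda|t|)}{2\lambda^{2H}},\qquad \mathbb V(X_t)=\frac{\sigma^2\,\Gamma(2H+1)}{2\lambda^{2H}}.$$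 -/

import Mathlib

open MeasureTheory ProbabilityTheory Filter Topology

noncomputable section

/-- A fractional Brownian motion on the whole line with Hurst parameter `H ∈ (0, 1]`:
an almost surely continuous centred Gaussian process with covariance
`(|t|^{2H} + |s|^{2H} - |t - s|^{2H}) / 2`. -/
structure IsFractionalBrownianMotion {Ω : Type*} [MeasurableSpace Ω]
    (B : ℝ → Ω → ℝ) (H : ℝ) (P : Measure Ω) : Prop where
  hurst_pos : 0 < H
  hurst_le_one : H ≤ 1
  gaussian : IsGaussianProcess B P
  continuous_paths : ∀ᵐ ω ∂P, Continuous fun t => B t ω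
  centered : ∀ t, ∫ ω, B t ω ∂P = 0
  covariance_eq : ∀ t s, ∫ ω, B t ω * B s ω ∂P
    = (1 / 2) * (|t| ^ (2 * H) + |s| ^ (2 * H) - |t - s| ^ (2 * H))

/-- `I` is the Riemann–Stieltjes integral `∫_a^b f dg` (with `a ≤ b`): the sums
`∑ f(c_i) (g(x_{i+1}) - g(x_i))` over tagged partitions `a = x_0 ≤ x_1 ≤ ⋯ ≤ x_n = b`,
`x_i ≤ c_i ≤ x_{i+1}`, tend to `I` as the mesh tends to `0`. -/
def IsRiemannStieltjesIntegral (f g : ℝ → ℝ) (a b I : ℝ) : Prop :=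
  a ≤ b ∧ ∀ ε > 0, ∃ δ > 0, ∀ (n : ℕ) (x c : ℕ → ℝ), x 0 = a → x n = b →
    (∀ i < n, x i ≤ c i ∧ c i ≤ x (i + 1) ∧ x (i + 1) - x i < δ) →
    |∑ i ∈ Finset.range n, f (c i) * (g (x (i + 1)) - g (x i)) - I| < ε

/-- `I` is the improper Riemann–Stieltjes integral
`∫_{-∞}^b f dg = lim_{a → -∞} ∫_a^b f dg`; all the integrals and the limit exist. -/
def IsImproperRiemannStieltjesIntegral (f g : ℝ → ℝ) (b I : ℝ) : Prop :=
  ∃ J : ℝ → ℝ, (∀ a ≤ b, IsRiemannStieltjesIntegral f g a b (J a)) ∧ Tendsto J atBot (𝓝 I)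

/-- `v` is the value at `t` of the Ornstein–Uhlenbeck operator with parameter `lam` applied to
the path `y`, that is `v = T_lam(y)(t) = ∫_{-∞}^t e^{-lam (t - s)} dy(s)`. -/
def IsOUOperatorValue (lam : ℝ) (y : ℝ → ℝ) (t v : ℝ) : Prop :=
  IsImproperRiemannStieltjesIntegral (fun s => Real.exp (-lam * (t - s))) y t v

/-- `X ∼ FOU(lam, σ, H)`: there is a fractional Brownian motion `B` with Hurst parameter `H` such
that, for every `t`, almost surely `X_t = T_lam(σ B)(t) = σ ∫_{-∞}^t e^{-lam (t - s)} dB(s)`. -/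
structure IsFOU {Ω : Type*} [MeasurableSpace Ω]
    (X : ℝ → Ω → ℝ) (lam σ H : ℝ) (P : Measure Ω) : Prop where
  lam_pos : 0 < lam
  sigma_pos : 0 < σ
  exists_fbm : ∃ B : ℝ → Ω → ℝ, IsFractionalBrownianMotion B H P ∧
    ∀ t, ∀ᵐ ω ∂P, IsOUOperatorValue lam (fun s => σ * B s ω) t (X t ω)

/-- `f_H^{(1)}(x) = e^{-x} (Γ(2H) - ∫_0^x e^s s^{2H-1} ds)`, used for `x ≥ 0`. -/
def fH1 (H x : ℝ) : ℝ :=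
  Real.exp (-x) * (Real.Gamma (2 * H) - ∫ s in (0 : ℝ)..x, Real.exp s * s ^ (2 * H - 1))

/-- `f_H^{(2)}(x) = e^x (Γ(2H) - ∫_0^x e^{-s} s^{2H-1} ds)`, used for `x ≥ 0`. -/
def fH2 (H x : ℝ) : ℝ :=
  Real.exp x * (Real.Gamma (2 * H) - ∫ s in (0 : ℝ)..x, Real.exp (-s) * s ^ (2 * H - 1))

/-- `f_H = f_H^{(1)} + f_H^{(2)}`, used for `x ≥ 0`. -/
def fH (H x : ℝ) : ℝ := fH1 H x + fH2 H x

end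

/-! In `L²` the process `B` is a curve whose Gram kernel is the fractional covariance, so it is
`H`-Hölder there: `‖B_s - B_t‖ = |s - t|^H`. Integration by parts turns the Ornstein–Uhlenbeck
integral into `X_t = σ λ ∫_0^∞ e^{-λu} (B_t - B_{t-u}) du`, an absolutely convergent `L²`-valued
integral. The same Riemann–Stieltjes sums converge pathwise and in `L²`, so the two readings agree
almost surely (`ae_eq_ouTransform`).

Inner products then pass through the integrals. With `D(x) = ∫_0^∞ e^{-λv} |x - v|^{2H} dv`, one has
`D' = |x|^{2H} - λD`, which evaluates the second integration and gives covariance `σ²/2 · (λ(D(x) +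
D(-x))/2 - |x|^{2H})` at lag `x` (`inner_ouTransform`). Solving for `D` and integrating by parts
produces `fH` (`half_discountedPower_sub`). -/

/-! ### Exponential domination on the half line. -/

/-- A power of order between `0` and `2` is dominated by an exponential of any positive rate. -/
theorem abs_rpow_le_exp {p ε : ℝ} (hp : 0 ≤ p) (hp2 : p ≤ 2) (hε : 0 < ε) (x : ℝ) :
    |x| ^ p ≤ (1 + 2 / ε ^ 2) * Real.exp (ε * |x|) := by
  have h1 : |x| ^ p ≤ 1 + x ^ 2 := by
    rcases le_total |x| 1 with h | h
    · have := Real.rpow_le_one (abs_nonneg x) h hp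
      nlinarith [sq_nonneg x]
    · have := Real.rpow_le_rpow_of_exponent_le h hp2
      rw [Real.rpow_two, sq_abs] at this
      linarith
  have h2 : 0 ≤ ε * |x| := by positivity
  have h3 := Real.quadratic_le_exp_of_nonneg h2
  -- The constant comes from `y² / 2 ≤ e^y` at `y = ε|x|`.
  have h4 : x ^ 2 = 2 / ε ^ 2 * ((ε * |x|) ^ 2 / 2) := by
    rw [mul_pow, sq_abs]; field_simp
  have h5 : 2 / ε ^ 2 * ((ε * |x|) ^ 2 / 2) ≤ 2 / ε ^ 2 * Real.exp (ε * |x|) := by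
    gcongr; nlinarith
  have h6 : (1 : ℝ) ≤ Real.exp (ε * |x|) := Real.one_le_exp h2
  nlinarith

/-- Continuous curves of exponential growth rate `l / 2` are integrable against `e^{-l u}`. -/
theorem integrableOn_exp_smul {E : Type*} [NormedAddCommGroup E] [NormedSpace ℝ E]
    {l K : ℝ} (hl : 0 < l) {g : ℝ → E} (hg : Continuous g)
    (hK : ∀ u, 0 < u → ‖g u‖ ≤ K * Real.exp (l / 2 * u)) :
    IntegrableOn (fun u => Real.exp (-l * u) • g u) (Set.Ioi 0) := by
  refine Integrable.mono' (g := fun u => K * Real.exp (-(l / 2) * u))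
    ((exp_neg_integrableOn_Ioi 0 (half_pos hl)).const_mul K)
    (by fun_prop) ?_
  refine (ae_restrict_iff' measurableSet_Ioi).2 (Eventually.of_forall fun u hu => ?_)
  rw [norm_smul, Real.norm_eq_abs, Real.abs_exp]
  calc _ ≤ Real.exp (-l * u) * (K * Real.exp (l / 2 * u)) := by gcongr; exact hK u hu
    _ = K * (Real.exp (-l * u) * Real.exp (l / 2 * u)) := by ring
    _ = _ := by rw [← Real.exp_add]; ring_nf

theorem setIntegral_Ioi_comp_sub (f : ℝ → ℝ) (a : ℝ) :
    ∫ v in Set.Ioi 0, f (v - a) = ∫ w in Set.Ioi (-a), f w := by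
  have h := (measurePreserving_sub_right volume a).setIntegral_preimage_emb
    (measurableEmbedding_subRight a) f (Set.Ioi (-a))
  simpa using h

/-! ### The discounted power and its differential equation. -/

/-- The exponentially discounted integral of `|x - v|^p` over `v > 0`. -/
noncomputable def discountedPower (l p x : ℝ) : ℝ :=
  ∫ v in Set.Ioi 0, Real.exp (-l * v) * |x - v| ^ p

section

variable {l p : ℝ}

theorem continuous_abs_sub_rpow (hp : 0 < p) (x : ℝ) : Continuous fun v : ℝ => |x - v| ^ p :=
  (by fun_prop : Continuous fun v : ℝ => |x - v|).rpow_const fun _ => Or.inr hp.le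

/-- The rate `l / 2` is half the discount rate, so a factor `e^{-lv/2}` survives for integration. -/
theorem abs_sub_rpow_le (hl : 0 < l) (hp : 0 < p) (hp2 : p ≤ 2) (x : ℝ) {v : ℝ} (hv : 0 < v) :
    |x - v| ^ p ≤ (1 + 2 / (l / 2) ^ 2) * Real.exp (l / 2 * |x|) * Real.exp (l / 2 * v) := by
  refine (abs_rpow_le_exp hp.le hp2 (half_pos hl) _).trans ?_
  rw [mul_assoc, ← Real.exp_add]
  have : |x - v| ≤ |x| + v := by
    simpa [abs_of_pos hv] using abs_sub x v
  gcongr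
  nlinarith

theorem integrableOn_exp_mul_abs_sub_rpow (hl : 0 < l) (hp : 0 < p) (hp2 : p ≤ 2) (x : ℝ) :
    IntegrableOn (fun v => Real.exp (-l * v) * |x - v| ^ p) (Set.Ioi 0) := by
  simpa only [smul_eq_mul] using integrableOn_exp_smul hl (continuous_abs_sub_rpow hp x)
    (K := (1 + 2 / (l / 2) ^ 2) * Real.exp (l / 2 * |x|)) fun u hu => by
      rw [Real.norm_eq_abs, abs_of_nonneg (by positivity)]
      exact abs_sub_rpow_le hl hp hp2 x hu

theorem abs_add_eq_abs_neg_sub (x v : ℝ) : |x + v| = |-x - v| := by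
  rw [← abs_neg]; ring_nf

theorem integrableOn_exp_mul_abs_add_rpow (hl : 0 < l) (hp : 0 < p) (hp2 : p ≤ 2) (x : ℝ) :
    IntegrableOn (fun v => Real.exp (-l * v) * |x + v| ^ p) (Set.Ioi 0) := by
  simpa only [abs_add_eq_abs_neg_sub] using integrableOn_exp_mul_abs_sub_rpow hl hp hp2 (-x)

theorem integral_exp_mul_abs_add_rpow (x : ℝ) :
    ∫ v in Set.Ioi 0, Real.exp (-l * v) * |x + v| ^ p = discountedPower l p (-x) := by
  simp only [abs_add_eq_abs_neg_sub, discountedPower]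

theorem integral_exp_neg_mul_Ioi_zero (hl : 0 < l) :
    ∫ v in Set.Ioi 0, Real.exp (-l * v) = 1 / l := by
  rw [integral_exp_mul_Ioi (neg_neg_of_pos hl)]
  simp

/-- Shifting `v` by `x` turns the integral into one over `(-x, ∞)`, which splits at `0`. This is
variation of constants, with `x` only in elementary places. -/
theorem discountedPower_eq (hl : 0 < l) (hp : 0 < p) (hp2 : p ≤ 2) (x : ℝ) :
    discountedPower l p x = Real.exp (-l * x) *
      (discountedPower l p 0 + ∫ w in (0 : ℝ)..x, Real.exp (l * w) * |w| ^ p) := by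
  have h0 := integrableOn_exp_mul_abs_sub_rpow hl hp hp2 0
  have hc : Continuous fun v : ℝ => Real.exp (-l * v) * |0 - v| ^ p :=
    (by fun_prop : Continuous fun v : ℝ => Real.exp (-l * v)).mul (continuous_abs_sub_rpow hp 0)
  have h1 := setIntegral_Ioi_comp_sub (fun v => Real.exp (-l * v) * |0 - v| ^ p) x
  have h2 := intervalIntegral.integral_interval_add_Ioi'
    (f := fun v => Real.exp (-l * v) * |0 - v| ^ p) (hc.intervalIntegrable (-x) 0) h0
  have h3 : ∫ v in (-x)..0, Real.exp (-l * v) * |0 - v| ^ p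
      = ∫ w in (0 : ℝ)..x, Real.exp (l * w) * |w| ^ p := by
    have := intervalIntegral.integral_comp_neg (a := -x) (b := 0)
      (fun w => Real.exp (l * w) * |w| ^ p)
    simpa using this
  rw [h3, ← h1] at h2
  rw [discountedPower, discountedPower, add_comm, h2, ← integral_const_mul]
  congr 1
  ext v
  rw [← mul_assoc, ← Real.exp_add]
  ring_nf

theorem hasDerivAt_discountedPower (hl : 0 < l) (hp : 0 < p) (hp2 : p ≤ 2) (x : ℝ) :
    HasDerivAt (discountedPower l p) (|x| ^ p - l * discountedPower l p x) x := by
  have hc : Continuous fun w : ℝ => Real.exp (l * w) * |w| ^ p := by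
    have := continuous_abs_sub_rpow hp 0
    simp only [zero_sub, abs_neg] at this
    fun_prop
  have h1 : HasDerivAt (fun x => ∫ w in (0 : ℝ)..x, Real.exp (l * w) * |w| ^ p)
      (Real.exp (l * x) * |x| ^ p) x := hc.integral_hasStrictDerivAt 0 x |>.hasDerivAt
  have h2 : HasDerivAt (fun x : ℝ => Real.exp (-l * x)) (Real.exp (-l * x) * (-l * 1)) x :=
    ((hasDerivAt_id x).const_mul (-l)).exp
  have h3 := h2.mul (h1.const_add (discountedPower l p 0))
  rw [show discountedPower l p = _ from funext (discountedPower_eq hl hp hp2)]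
  refine h3.congr_deriv ?_
  beta_reduce
  have : Real.exp (-l * x) * (Real.exp (l * x) * |x| ^ p) = |x| ^ p := by
    rw [← mul_assoc, ← Real.exp_add]; simp
  rw [this]; ring

theorem abs_discountedPower_le (hl : 0 < l) (hp : 0 < p) (hp2 : p ≤ 2) :
    ∃ K, ∀ x, |discountedPower l p x| ≤ K * Real.exp (l / 2 * |x|) := by
  refine ⟨∫ v in Set.Ioi 0, (1 + 2 / (l / 2) ^ 2) * Real.exp (-(l / 2) * v), fun x => ?_⟩
  rw [discountedPower, ← integral_mul_const]
  refine norm_integral_le_of_norm_le (G := ℝ)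
    (((exp_neg_integrableOn_Ioi 0 (half_pos hl)).const_mul _).mul_const _) ?_
  refine (ae_restrict_iff' measurableSet_Ioi).2 (Eventually.of_forall fun v hv => ?_)
  rw [Real.norm_eq_abs, abs_of_nonneg (by positivity)]
  calc _ ≤ Real.exp (-l * v) *
        ((1 + 2 / (l / 2) ^ 2) * Real.exp (l / 2 * |x|) * Real.exp (l / 2 * v)) := by
        gcongr; exact abs_sub_rpow_le hl hp hp2 x hv
    _ = (1 + 2 / (l / 2) ^ 2) * (Real.exp (-l * v) * Real.exp (l / 2 * v)) *
        Real.exp (l / 2 * |x|) := by ring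
    _ = _ := by rw [← Real.exp_add]; ring_nf

/-- Growth of the discounted power along the half line starting at `x`. -/
theorem abs_discountedPower_add_le (hl : 0 < l) (hp : 0 < p) (hp2 : p ≤ 2) (x : ℝ) :
    ∃ K, ∀ u, 0 < u → |discountedPower l p (x + u)| ≤ K * Real.exp (l / 2 * u) := by
  obtain ⟨K, hK⟩ := abs_discountedPower_le hl hp hp2
  have hK0 : 0 ≤ K := by
    have := (abs_nonneg _).trans (hK 0)
    simpa using this
  refine ⟨K * Real.exp (l / 2 * |x|), fun u hu => (hK _).trans ?_⟩
  rw [mul_assoc, ← Real.exp_add]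
  have : |x + u| ≤ |x| + u := by simpa [abs_of_pos hu] using abs_add_le x u
  gcongr
  nlinarith

theorem continuous_discountedPower (hl : 0 < l) (hp : 0 < p) (hp2 : p ≤ 2) :
    Continuous (discountedPower l p) :=
  continuous_iff_continuousAt.2 fun x => (hasDerivAt_discountedPower hl hp hp2 x).continuousAt

theorem integrableOn_exp_mul_discountedPower (hl : 0 < l) (hp : 0 < p) (hp2 : p ≤ 2) (x : ℝ) :
    IntegrableOn (fun u => Real.exp (-l * u) * discountedPower l p (x + u)) (Set.Ioi 0) := by
  obtain ⟨K, hK⟩ := abs_discountedPower_add_le hl hp hp2 x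
  have hc : Continuous fun u => discountedPower l p (x + u) :=
    (continuous_discountedPower hl hp hp2).comp (continuous_const_add x)
  simpa only [smul_eq_mul] using integrableOn_exp_smul hl hc hK

/-- By the differential equation, `e^{-lu} D(x + u)` has derivative `e^{-lu} |x + u|^p - 2l e^{-lu}
D(x + u)`. Integrated over `u > 0`, the boundary gives `-D(x)` and the first term `D(-x)`. -/
theorem integral_exp_mul_discountedPower (hl : 0 < l) (hp : 0 < p) (hp2 : p ≤ 2) (x : ℝ) :
    ∫ u in Set.Ioi 0, Real.exp (-l * u) * discountedPower l p (x + u)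
      = (discountedPower l p x + discountedPower l p (-x)) / (2 * l) := by
  have hd (u : ℝ) : HasDerivAt (fun u => Real.exp (-l * u) * discountedPower l p (x + u))
      (Real.exp (-l * u) * |x + u| ^ p
        - 2 * l * (Real.exp (-l * u) * discountedPower l p (x + u))) u := by
    have h2 : HasDerivAt (fun x : ℝ => Real.exp (-l * x)) (Real.exp (-l * u) * (-l * 1)) u :=
      ((hasDerivAt_id u).const_mul (-l)).exp
    have h3 := HasDerivAt.comp_const_add x u (hasDerivAt_discountedPower hl hp hp2 (x + u))
    refine (h2.mul h3).congr_deriv ?_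
    ring
  have hi1 := integrableOn_exp_mul_abs_add_rpow hl hp hp2 x
  have hi2 := integrableOn_exp_mul_discountedPower hl hp hp2 x
  have hlim : Tendsto (fun u => Real.exp (-l * u) * discountedPower l p (x + u)) atTop (𝓝 0) := by
    obtain ⟨K, hK⟩ := abs_discountedPower_add_le hl hp hp2 x
    have h0 : Tendsto (fun u => K * Real.exp (-(l / 2 * u))) atTop (𝓝 (K * 0)) :=
      (Real.tendsto_exp_neg_atTop_nhds_zero.comp
        (tendsto_id.const_mul_atTop (half_pos hl))).const_mul K
    rw [mul_zero] at h0
    refine squeeze_zero_norm' ?_ h0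
    filter_upwards [eventually_gt_atTop 0] with u hu
    rw [norm_mul, Real.norm_eq_abs, Real.norm_eq_abs, Real.abs_exp]
    calc _ ≤ Real.exp (-l * u) * (K * Real.exp (l / 2 * u)) := by gcongr; exact hK u hu
      _ = K * (Real.exp (-l * u) * Real.exp (l / 2 * u)) := by ring
      _ = _ := by rw [← Real.exp_add]; ring_nf
  have h := integral_Ioi_of_hasDerivAt_of_tendsto (hd 0).continuousAt.continuousWithinAt
    (fun u _ => hd u) (hi1.sub (hi2.const_mul (2 * l))) hlim
  rw [integral_sub hi1 (hi2.const_mul (2 * l)), integral_const_mul,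
    integral_exp_mul_abs_add_rpow] at h
  simp only [mul_zero, Real.exp_zero, add_zero, one_mul] at h
  rw [eq_div_iff (by positivity)]
  linarith

theorem discountedPower_zero (hl : 0 < l) (hp : 0 < p) :
    discountedPower l p 0 = Real.Gamma (p + 1) / l ^ (p + 1) := by
  have h := Real.integral_rpow_mul_exp_neg_mul_Ioi (a := p + 1) (by linarith) hl
  rw [Real.div_rpow zero_le_one hl.le, Real.one_rpow] at h
  rw [discountedPower, div_eq_mul_one_div, mul_comm, ← h]
  refine setIntegral_congr_fun measurableSet_Ioi fun v hv => ?_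
  simp [abs_of_pos (Set.mem_Ioi.1 hv), mul_comm]

/-- Integration by parts for `e^{k s} s^p`. -/
theorem integral_exp_mul_rpow_by_parts (hp : 1 < p) (k x : ℝ) :
    k * ∫ s in (0 : ℝ)..x, Real.exp (k * s) * s ^ p
      = Real.exp (k * x) * x ^ p - p * ∫ s in (0 : ℝ)..x, Real.exp (k * s) * s ^ (p - 1) := by
  have hd (s : ℝ) : HasDerivAt (fun s : ℝ => Real.exp (k * s)) (Real.exp (k * s) * (k * 1)) s :=
    ((hasDerivAt_id s).const_mul k).exp
  have hv (s : ℝ) : HasDerivAt (fun s : ℝ => s ^ p) (p * s ^ (p - 1)) s :=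
    Real.hasDerivAt_rpow_const (Or.inr hp.le)
  have hc : Continuous fun s : ℝ => s ^ (p - 1) :=
    continuous_id.rpow_const fun _ => Or.inr (by linarith)
  have h := intervalIntegral.integral_mul_deriv_eq_deriv_mul (a := 0) (b := x)
    (fun s _ => hd s) (fun s _ => hv s)
    (by apply Continuous.intervalIntegrable; fun_prop)
    (by apply Continuous.intervalIntegrable; fun_prop)
  have e1 : ∫ s in (0 : ℝ)..x, Real.exp (k * s) * (p * s ^ (p - 1))
      = p * ∫ s in (0 : ℝ)..x, Real.exp (k * s) * s ^ (p - 1) := by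
    rw [← intervalIntegral.integral_const_mul]; congr 1; ext s; ring
  have e2 : ∫ s in (0 : ℝ)..x, Real.exp (k * s) * (k * 1) * s ^ p
      = k * ∫ s in (0 : ℝ)..x, Real.exp (k * s) * s ^ p := by
    rw [← intervalIntegral.integral_const_mul]; congr 1; ext s; ring
  rw [e1, e2, Real.zero_rpow (by linarith)] at h
  linarith

theorem integral_exp_mul_rpow_scale (hl : 0 < l) {k x : ℝ} (hx : 0 ≤ x) :
    ∫ w in (0 : ℝ)..x, Real.exp (k * (l * w)) * w ^ p
      = (∫ s in (0 : ℝ)..l * x, Real.exp (k * s) * s ^ p) / l ^ (p + 1) := by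
  have h := intervalIntegral.integral_comp_mul_left (a := 0) (b := x)
    (fun s => Real.exp (k * s) * s ^ p) hl.ne'
  have e : ∫ w in (0 : ℝ)..x, Real.exp (k * (l * w)) * (l * w) ^ p
      = l ^ p * ∫ w in (0 : ℝ)..x, Real.exp (k * (l * w)) * w ^ p := by
    rw [← intervalIntegral.integral_const_mul]
    refine intervalIntegral.integral_congr fun w hw => ?_
    rw [Set.uIcc_of_le hx] at hw
    simp only [Real.mul_rpow hl.le hw.1]
    ring
  rw [e, mul_zero, smul_eq_mul] at h
  have hlp : 0 < l ^ p := Real.rpow_pos_of_pos hl p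
  rw [Real.rpow_add_one hl.ne', eq_div_iff (by positivity)]
  calc _ = l * (l ^ p * ∫ w in (0 : ℝ)..x, Real.exp (k * (l * w)) * w ^ p) := by ring
    _ = _ := by rw [h]; field_simp

end

/-- Closed form of the stationary covariance kernel in terms of `fH`. -/
theorem half_discountedPower_sub {l H x : ℝ} (hl : 0 < l) (hH : 1 / 2 < H) (hH1 : H ≤ 1) :
    1 / 2 * (l * (discountedPower l (2 * H) x + discountedPower l (2 * H) (-x)) / 2
      - |x| ^ (2 * H)) = H * fH H (l * |x|) / (2 * l ^ (2 * H)) := by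
  wlog hx : 0 ≤ x generalizing x
  · have := this (x := -x) (by linarith)
    rw [neg_neg, abs_neg, add_comm] at this
    exact this
  have hp : 0 < 2 * H := by linarith
  have e1 : ∫ w in (0 : ℝ)..x, Real.exp (l * w) * |w| ^ (2 * H)
      = ∫ w in (0 : ℝ)..x, Real.exp (1 * (l * w)) * w ^ (2 * H) := by
    refine intervalIntegral.integral_congr fun w hw => ?_
    rw [Set.uIcc_of_le hx] at hw
    simp [abs_of_nonneg hw.1]
  have e2 : ∫ w in (0 : ℝ)..(-x), Real.exp (l * w) * |w| ^ (2 * H)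
      = - ∫ w in (0 : ℝ)..x, Real.exp (-1 * (l * w)) * w ^ (2 * H) := by
    have h := intervalIntegral.integral_comp_neg (a := 0) (b := x)
      (fun w => Real.exp (l * w) * |w| ^ (2 * H))
    rw [neg_zero, intervalIntegral.integral_symm 0 (-x)] at h
    rw [eq_comm, neg_eq_iff_eq_neg, ← h]
    refine intervalIntegral.integral_congr fun w hw => ?_
    rw [Set.uIcc_of_le hx] at hw
    simp [abs_of_nonneg hw.1]
  rw [discountedPower_eq hl hp (by linarith) x, discountedPower_eq hl hp (by linarith) (-x),
    e1, e2, discountedPower_zero hl hp, integral_exp_mul_rpow_scale hl hx,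
    integral_exp_mul_rpow_scale hl hx, abs_of_nonneg hx, fH, fH1, fH2]
  -- Here `1 / 2 < H` matters: `s^{2H}` is then continuously differentiable at `0` too.
  have p1 := integral_exp_mul_rpow_by_parts (p := 2 * H) (by linarith) 1 (l * x)
  have p2 := integral_exp_mul_rpow_by_parts (p := 2 * H) (by linarith) (-1) (l * x)
  have hx1 : x ^ (2 * H) = (l * x) ^ (2 * H) / l ^ (2 * H) := by
    rw [Real.mul_rpow hl.le hx, mul_div_cancel_left₀ _ (Real.rpow_pos_of_pos hl _).ne']
  have hexp : Real.exp (-(l * x)) * Real.exp (l * x) = 1 := by rw [← Real.exp_add]; simp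
  simp only [one_mul, neg_mul, mul_neg, neg_neg] at p1 p2 ⊢
  rw [p1, show ∫ s in (0 : ℝ)..l * x, Real.exp (-s) * s ^ (2 * H) = _ from neg_eq_iff_eq_neg.1 p2,
    hx1, Real.Gamma_add_one hp.ne', Real.rpow_add_one hl.ne']
  have hlp : 0 < l ^ (2 * H) := Real.rpow_pos_of_pos hl _
  generalize (∫ s in (0 : ℝ)..l * x, Real.exp s * s ^ (2 * H - 1)) = I1
  generalize (∫ s in (0 : ℝ)..l * x, Real.exp (-s) * s ^ (2 * H - 1)) = I2
  generalize (l * x) ^ (2 * H) = z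
  generalize l ^ (2 * H) = q at *
  generalize Real.Gamma (2 * H) = G
  field_simp
  -- The two boundary terms of the integrations by parts cancel `|x|^{2H}`.
  linear_combination 2 * z * hexp

/-! ### Riemann–Stieltjes sums of Banach-valued Hölder curves. -/

section

variable {E : Type*} [NormedAddCommGroup E] [NormedSpace ℝ E]

/-- Riemann–Stieltjes sums over uniform partitions, against a Hölder continuous curve,
converge to the value given by integration by parts. -/
theorem tendsto_riemannStieltjes_sum [CompleteSpace E] {f f' : ℝ → ℝ} {b : ℝ → E} {H M a c : ℝ}
    (hH : 0 < H) (hac : a ≤ c) (hf : ∀ s, HasDerivAt f (f' s) s) (hf' : Continuous f')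
    (hM : ∀ s ≤ c, |f' s| ≤ M) (hb : ∀ s t, ‖b s - b t‖ ≤ |s - t| ^ H) :
    Tendsto (fun m : ℕ => ∑ i ∈ Finset.range (m + 1),
        f (a + ((i + 1 : ℕ) : ℝ) * ((c - a) / (m + 1))) •
          (b (a + ((i + 1 : ℕ) : ℝ) * ((c - a) / (m + 1))) - b (a + (i : ℝ) * ((c - a) / (m + 1)))))
      atTop (𝓝 (f c • b c - f a • b a - ∫ s in a..c, f' s • b s)) := by
  have hbc : Continuous b := by
    refine continuous_iff_continuousAt.2 fun t => ?_
    refine tendsto_iff_norm_sub_tendsto_zero.2 (squeeze_zero (fun _ => norm_nonneg _)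
      (fun s => hb s t) ?_)
    have h : Continuous fun s : ℝ => |s - t| ^ H :=
      (by fun_prop : Continuous fun s : ℝ => |s - t|).rpow_const fun _ => Or.inr hH.le
    simpa [Real.zero_rpow hH.ne'] using h.tendsto t
  have hδ : Tendsto (fun m : ℕ => M * ((c - a) / (m + 1)) ^ H * (c - a)) atTop (𝓝 0) := by
    have h1 : Tendsto (fun m : ℕ => (c - a) / ((m : ℝ) + 1)) atTop (𝓝 0) :=
      tendsto_const_nhds.div_atTop (tendsto_natCast_atTop_atTop.atTop_add tendsto_const_nhds)
    have h2 := ((h1.rpow_const (Or.inr hH.le)).const_mul M).mul_const (c - a)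
    simpa [Real.zero_rpow hH.ne'] using h2
  refine tendsto_iff_norm_sub_tendsto_zero.2 (squeeze_zero (fun _ => norm_nonneg _) (fun m => ?_) hδ)
  set d : ℝ := (c - a) / (m + 1) with hd
  have hd0 : 0 ≤ d := div_nonneg (by linarith) (by positivity)
  have hmd : ((m + 1 : ℕ) : ℝ) * d = c - a := by
    rw [hd]; push_cast; field_simp
  set x : ℕ → ℝ := fun i => a + (i : ℝ) * d with hx
  have hxs (i : ℕ) : x (i + 1) - x i = d := by simp only [hx]; push_cast; ring
  have hx0 : x 0 = a := by simp [hx]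
  have hxm : x (m + 1) = c := by simp only [hx]; rw [hmd]; ring
  have hxc (i : ℕ) (hi : i < m + 1) : x (i + 1) ≤ c := by
    rw [← hxm]; simp only [hx]; gcongr; omega
  have hint (g : ℝ → E) (hg : Continuous g) (u v : ℝ) :
      IntervalIntegrable (fun s => f' s • g s) volume u v :=
    (hf'.smul hg).intervalIntegrable u v
  -- Summation by parts: after telescoping, the error is the sum of `∫ f' (b s - b (x i))`, each of
  -- norm at most `M d^H d`.
  have hterm (i : ℕ) : f (x (i + 1)) • (b (x (i + 1)) - b (x i))
      = (f (x (i + 1)) • b (x (i + 1)) - f (x i) • b (x i))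
        - ∫ s in x i..x (i + 1), f' s • b (x i) := by
    rw [intervalIntegral.integral_smul_const, intervalIntegral.integral_eq_sub_of_hasDerivAt
      (fun s _ => hf s) (hf'.intervalIntegrable _ _)]
    module
  have hsum : ∑ i ∈ Finset.range (m + 1), f (x (i + 1)) • (b (x (i + 1)) - b (x i))
      - (f c • b c - f a • b a - ∫ s in a..c, f' s • b s)
      = ∑ i ∈ Finset.range (m + 1), ∫ s in x i..x (i + 1), f' s • (b s - b (x i)) := by
    have h1 := intervalIntegral.sum_integral_adjacent_intervals (a := x) (n := m + 1)
      (fun k _ => hint b hbc (x k) (x (k + 1)))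
    have h2 := Finset.sum_range_sub (fun i => f (x i) • b (x i)) (m + 1)
    rw [hx0, hxm] at h1 h2
    simp_rw [hterm, Finset.sum_sub_distrib, smul_sub]
    rw [← Finset.sum_sub_distrib, h2, ← h1]
    simp_rw [intervalIntegral.integral_sub (hint b hbc _ _) (hint _ continuous_const _ _)]
    rw [Finset.sum_sub_distrib]
    abel
  have hbd (i : ℕ) (hi : i ∈ Finset.range (m + 1)) :
      ‖∫ s in x i..x (i + 1), f' s • (b s - b (x i))‖ ≤ M * d ^ H * d := by
    have := intervalIntegral.norm_integral_le_of_norm_le_const (a := x i) (b := x (i + 1))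
      (f := fun s => f' s • (b s - b (x i))) (C := M * d ^ H) fun s hs => by
        rw [Set.uIoc_of_le (by linarith [hxs i])] at hs
        rw [norm_smul, Real.norm_eq_abs]
        have h1 := hM s (hs.2.trans (hxc i (Finset.mem_range.1 hi)))
        have h2 : |s - x i| ^ H ≤ d ^ H := by
          rw [abs_of_pos (by linarith [hs.1])]
          exact Real.rpow_le_rpow (by linarith [hs.1]) (by linarith [hs.2, hxs i]) hH.le
        exact mul_le_mul h1 ((hb _ _).trans h2) (norm_nonneg _) ((abs_nonneg _).trans h1)
    rwa [hxs i, abs_of_nonneg hd0] at this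
  change ‖∑ i ∈ Finset.range (m + 1), f (x (i + 1)) • (b (x (i + 1)) - b (x i)) - _‖ ≤ _
  rw [hsum]
  refine (norm_sum_le_of_le _ hbd).trans_eq ?_
  rw [Finset.sum_const, Finset.card_range, nsmul_eq_mul, ← hmd]
  ring

/-- The Ornstein–Uhlenbeck transform of a curve: `∫_0^∞ e^{-l u} (b t - b (t - u)) du`,
which is `1 / l` times the value at `t` of the Ornstein–Uhlenbeck operator. -/
noncomputable def ouTransform (l : ℝ) (b : ℝ → E) (t : ℝ) : E :=
  ∫ u in Set.Ioi 0, Real.exp (-l * u) • (b t - b (t - u))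

/-- The value of the Ornstein–Uhlenbeck integral over `[t - n, t]`. -/
noncomputable def ouPartial (l : ℝ) (b : ℝ → E) (t n : ℝ) : E :=
  Real.exp (-l * n) • (b t - b (t - n))
    + l • ∫ u in (0 : ℝ)..n, Real.exp (-l * u) • (b t - b (t - u))

theorem tendsto_sum_ouPartial [CompleteSpace E] {b : ℝ → E} {H l n : ℝ}
    (hH : 0 < H) (hl : 0 < l) (hn : 0 ≤ n) (hb : ∀ s t, ‖b s - b t‖ ≤ |s - t| ^ H) (t : ℝ) :
    Tendsto (fun m : ℕ => ∑ i ∈ Finset.range (m + 1),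
        Real.exp (-l * (t - (t - n + ((i + 1 : ℕ) : ℝ) * (n / (m + 1))))) •
          (b (t - n + ((i + 1 : ℕ) : ℝ) * (n / (m + 1))) - b (t - n + (i : ℝ) * (n / (m + 1)))))
      atTop (𝓝 (ouPartial l b t n)) := by
  have hf (s : ℝ) : HasDerivAt (fun s => Real.exp (-l * (t - s))) (l * Real.exp (-l * (t - s))) s := by
    refine (((hasDerivAt_id s).const_sub t).const_mul (-l)).exp.congr_deriv ?_
    simp; ring
  -- Recentring the curve at `b t` leaves increments unchanged and kills the boundary term at `t`.
  have h := tendsto_riemannStieltjes_sum (b := fun s => b s - b t) (M := l) hH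
    (sub_le_self t hn) hf (by fun_prop) (fun s hs => by
      rw [abs_of_pos (by positivity)]
      refine mul_le_of_le_one_right hl.le (Real.exp_le_one_iff.2 ?_)
      nlinarith) (fun s r => by simpa using hb s r)
  simp only [sub_sub_sub_cancel_right, sub_sub_cancel, sub_self, smul_zero, zero_sub] at h
  convert h using 2
  have h2 := intervalIntegral.integral_comp_sub_left (a := 0) (b := n)
    (fun s => (l * Real.exp (-l * (t - s))) • (b s - b t)) t
  simp only [sub_zero, sub_sub_cancel] at h2
  rw [ouPartial, ← h2, ← intervalIntegral.integral_smul, ← smul_neg, neg_sub,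
    sub_eq_add_neg _ (∫ s in _..n, _), ← intervalIntegral.integral_neg]
  congr 2
  ext u
  rw [smul_smul, ← smul_neg, neg_sub]

end

theorem integral_add_sub_sub {α : Type*} [MeasurableSpace α] {μ : Measure α} {f g h k : α → ℝ}
    (hf : Integrable f μ) (hg : Integrable g μ) (hh : Integrable h μ) (hk : Integrable k μ) :
    ∫ x, (f x + g x - h x - k x) ∂μ = ∫ x, f x ∂μ + ∫ x, g x ∂μ - ∫ x, h x ∂μ - ∫ x, k x ∂μ := by
  have := integral_sub' ((hf.add hg).sub hh) hk
  rwa [integral_sub' (hf.add hg) hh, integral_add' hf hg] at this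

/-! ### Fractional curves in a Hilbert space and the Gram kernel of their transform. -/

section

variable {E : Type*} [NormedAddCommGroup E] [InnerProductSpace ℝ E]

/-- A curve in a Hilbert space whose Gram kernel is the covariance of fractional Brownian motion. -/
def IsFractionalCurve (b : ℝ → E) (H : ℝ) : Prop :=
  ∀ s t, inner ℝ (b s) (b t)
    = (1 / 2) * (|s| ^ (2 * H) + |t| ^ (2 * H) - |s - t| ^ (2 * H))

namespace IsFractionalCurve

variable {b : ℝ → E} {H l : ℝ}

/-- Stationarity of increments: the terms `|s|^{2H}` and `|t|^{2H}` cancel and only the lag `t - s`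
remains. -/
theorem inner_sub_sub (h : IsFractionalCurve b H) (s t u v : ℝ) :
    inner ℝ (b s - b (s - u)) (b t - b (t - v))
      = 1 / 2 * (|t - s - v| ^ (2 * H) + |t - s + u| ^ (2 * H) - |t - s| ^ (2 * H)
        - |t - s + u - v| ^ (2 * H)) := by
  simp only [inner_sub_left, inner_sub_right, h _ _]
  rw [show |s - t| = |t - s| from abs_sub_comm _ _,
    show |s - u - t| = |t - s + u| by rw [abs_sub_comm]; ring_nf,
    show |s - (t - v)| = |t - s - v| by rw [abs_sub_comm]; ring_nf,
    show |s - u - (t - v)| = |t - s + u - v| by rw [abs_sub_comm]; ring_nf]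
  ring

theorem norm_sub (h : IsFractionalCurve b H) (hH : 0 < H) (s t : ℝ) :
    ‖b s - b t‖ = |s - t| ^ H := by
  have h1 := h.inner_sub_sub s s (s - t) (s - t)
  have h2 : ‖b s - b t‖ ^ 2 = (|s - t| ^ H) ^ 2 := by
    rw [← real_inner_self_eq_norm_sq, ← Real.rpow_mul_natCast (abs_nonneg _)]
    simp only [sub_sub_cancel, sub_self, zero_sub, zero_add, abs_neg, abs_zero,
      Real.zero_rpow (show 2 * H ≠ 0 by positivity)] at h1
    rw [h1]; push_cast; ring_nf
  exact (sq_eq_sq₀ (norm_nonneg _) (by positivity)).1 h2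

theorem continuous (h : IsFractionalCurve b H) (hH : 0 < H) : Continuous b := by
  refine continuous_iff_continuousAt.2 fun t => tendsto_iff_norm_sub_tendsto_zero.2 ?_
  have hc : Continuous fun s : ℝ => |s - t| ^ H :=
    (by fun_prop : Continuous fun s : ℝ => |s - t|).rpow_const fun _ => Or.inr hH.le
  simpa [Real.zero_rpow hH.ne', h.norm_sub hH] using hc.tendsto t

theorem norm_increment_le (h : IsFractionalCurve b H) (hH : 0 < H) (hH1 : H ≤ 1) (hl : 0 < l)
    (t : ℝ) {u : ℝ} (hu : 0 < u) :
    ‖b t - b (t - u)‖ ≤ (1 + 2 / (l / 2) ^ 2) * Real.exp (l / 2 * u) := by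
  rw [h.norm_sub hH, sub_sub_cancel]
  simpa [abs_of_pos hu] using abs_rpow_le_exp hH.le (by linarith) (half_pos hl) u

theorem integrableOn_increment (h : IsFractionalCurve b H) (hH : 0 < H) (hH1 : H ≤ 1)
    (hl : 0 < l) (t : ℝ) :
    IntegrableOn (fun u => Real.exp (-l * u) • (b t - b (t - u))) (Set.Ioi 0) := by
  have hc := h.continuous hH
  exact integrableOn_exp_smul hl (by fun_prop) fun u hu => h.norm_increment_le hH hH1 hl t hu

theorem tendsto_ouPartial (h : IsFractionalCurve b H) (hH : 0 < H) (hH1 : H ≤ 1)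
    (hl : 0 < l) (t : ℝ) :
    Tendsto (fun n : ℕ => ouPartial l b t n) atTop (𝓝 (l • ouTransform l b t)) := by
  have h1 := (intervalIntegral_tendsto_integral_Ioi 0 (h.integrableOn_increment hH hH1 hl t)
    tendsto_natCast_atTop_atTop).const_smul l
  have h2 : Tendsto (fun n : ℕ => Real.exp (-l * n) • (b t - b (t - n))) atTop (𝓝 0) := by
    have h0 : Tendsto (fun u => (1 + 2 / (l / 2) ^ 2) * Real.exp (-(l / 2 * u))) atTop
        (𝓝 ((1 + 2 / (l / 2) ^ 2) * 0)) :=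
      (Real.tendsto_exp_neg_atTop_nhds_zero.comp
        (tendsto_id.const_mul_atTop (half_pos hl))).const_mul _
    rw [mul_zero] at h0
    refine squeeze_zero_norm' ?_ (h0.comp tendsto_natCast_atTop_atTop)
    filter_upwards [eventually_gt_atTop 0] with n hn
    rw [norm_smul, Real.norm_eq_abs, Real.abs_exp]
    calc _ ≤ Real.exp (-l * n) * ((1 + 2 / (l / 2) ^ 2) * Real.exp (l / 2 * n)) := by
          gcongr; exact h.norm_increment_le hH hH1 hl t (by exact_mod_cast hn)
      _ = (1 + 2 / (l / 2) ^ 2) * (Real.exp (-l * n) * Real.exp (l / 2 * n)) := by ring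
      _ = _ := by rw [← Real.exp_add]; simp only [Function.comp]; ring_nf
  simpa only [zero_add, ouPartial, ouTransform] using h2.add h1

theorem inner_increment_ouTransform [CompleteSpace E] (h : IsFractionalCurve b H) (hH : 0 < H)
    (hH1 : H ≤ 1) (hl : 0 < l) (s t u : ℝ) :
    inner ℝ (b s - b (s - u)) (ouTransform l b t)
      = 1 / 2 * (discountedPower l (2 * H) (t - s) + |t - s + u| ^ (2 * H) / l
        - |t - s| ^ (2 * H) / l - discountedPower l (2 * H) (t - s + u)) := by
  have hp : 0 < 2 * H := by linarith
  have hp2 : 2 * H ≤ 2 := by linarith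
  have i1 := integrableOn_exp_mul_abs_sub_rpow hl hp hp2 (t - s)
  have i2 := integrableOn_exp_mul_abs_sub_rpow hl hp hp2 (t - s + u)
  have i3 := exp_neg_integrableOn_Ioi 0 hl
  rw [ouTransform, ← integral_inner (h.integrableOn_increment hH hH1 hl t)]
  calc _ = ∫ v in Set.Ioi 0, 1 / 2 * (Real.exp (-l * v) * |t - s - v| ^ (2 * H)
          + Real.exp (-l * v) * |t - s + u| ^ (2 * H) - Real.exp (-l * v) * |t - s| ^ (2 * H)
          - Real.exp (-l * v) * |t - s + u - v| ^ (2 * H)) := by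
        congr 1; ext v; rw [inner_smul_right, h.inner_sub_sub]; ring
    _ = _ := by
        rw [integral_const_mul, integral_add_sub_sub i1 (i3.mul_const _) (i3.mul_const _) i2,
          integral_mul_const, integral_mul_const,
          integral_exp_neg_mul_Ioi_zero hl, discountedPower, discountedPower]
        ring

/-- Integrating `inner_increment_ouTransform` over `u` leaves one nontrivial integral, that of `D(t
- s + u)`, given by `integral_exp_mul_discountedPower`. -/
theorem inner_ouTransform [CompleteSpace E] (h : IsFractionalCurve b H) (hH : 0 < H)
    (hH1 : H ≤ 1) (hl : 0 < l) (s t : ℝ) :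
    l ^ 2 * inner ℝ (ouTransform l b s) (ouTransform l b t)
      = 1 / 2 * (l * (discountedPower l (2 * H) (t - s) + discountedPower l (2 * H) (-(t - s))) / 2
        - |t - s| ^ (2 * H)) := by
  have hp : 0 < 2 * H := by linarith
  have hp2 : 2 * H ≤ 2 := by linarith
  have i1 := integrableOn_exp_mul_abs_add_rpow hl hp hp2 (t - s)
  have i2 := integrableOn_exp_mul_discountedPower hl hp hp2 (t - s)
  have i3 := exp_neg_integrableOn_Ioi 0 hl
  have e : inner ℝ (ouTransform l b s) (ouTransform l b t)
      = ∫ u in Set.Ioi 0, inner ℝ (ouTransform l b t) (Real.exp (-l * u) • (b s - b (s - u))) := by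
    rw [integral_inner (h.integrableOn_increment hH hH1 hl s), real_inner_comm]
    rfl
  have e2 : ∫ u in Set.Ioi 0, inner ℝ (ouTransform l b t) (Real.exp (-l * u) • (b s - b (s - u)))
      = ∫ u in Set.Ioi 0, 1 / 2 * (Real.exp (-l * u) * discountedPower l (2 * H) (t - s)
          + Real.exp (-l * u) * |t - s + u| ^ (2 * H) / l
          - Real.exp (-l * u) * (|t - s| ^ (2 * H) / l)
          - Real.exp (-l * u) * discountedPower l (2 * H) (t - s + u)) := by
    congr 1; ext u
    rw [inner_smul_right, real_inner_comm, h.inner_increment_ouTransform hH hH1 hl]; ring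
  rw [e, e2, integral_const_mul, integral_add_sub_sub (i3.mul_const _) (i1.div_const l)
    (i3.mul_const _) i2, integral_mul_const, integral_mul_const,
    integral_div, integral_exp_neg_mul_Ioi_zero hl, integral_exp_mul_abs_add_rpow,
    integral_exp_mul_discountedPower hl hp hp2]
  field_simp
  ring

end IsFractionalCurve

end

/-! ### From pathwise integrals to `L²`. -/

theorem real_inner_eq_mul (x y : ℝ) : inner ℝ x y = x * y := by
  simp [mul_comm]

/-- Riemann–Stieltjes sums over uniform partitions converge to the integral. -/
theorem IsRiemannStieltjesIntegral.tendsto_sum {f g : ℝ → ℝ} {a c I : ℝ}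
    (h : IsRiemannStieltjesIntegral f g a c I) :
    Tendsto (fun m : ℕ => ∑ i ∈ Finset.range (m + 1),
        f (a + ((i + 1 : ℕ) : ℝ) * ((c - a) / (m + 1))) *
          (g (a + ((i + 1 : ℕ) : ℝ) * ((c - a) / (m + 1))) - g (a + (i : ℝ) * ((c - a) / (m + 1)))))
      atTop (𝓝 I) := by
  obtain ⟨hac, h⟩ := h
  refine Metric.tendsto_nhds.2 fun ε hε => ?_
  obtain ⟨δ, hδ, hI⟩ := h ε hε
  have h1 : Tendsto (fun m : ℕ => (c - a) / ((m : ℝ) + 1)) atTop (𝓝 0) :=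
    tendsto_const_nhds.div_atTop (tendsto_natCast_atTop_atTop.atTop_add tendsto_const_nhds)
  filter_upwards [h1.eventually_lt_const hδ] with m hm
  have hd0 : 0 ≤ (c - a) / ((m : ℝ) + 1) := div_nonneg (by linarith) (by positivity)
  refine hI (m + 1) (fun i => a + (i : ℝ) * ((c - a) / (m + 1)))
    (fun i => a + ((i + 1 : ℕ) : ℝ) * ((c - a) / (m + 1))) (by simp) ?_ fun i _ => ⟨?_, le_rfl, ?_⟩
  · push_cast; field_simp; ring
  · push_cast; linarith
  · push_cast; linarith

section

variable {Ω : Type*} [MeasurableSpace Ω] {P : Measure Ω}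

/-- A sequence converging in `L²` converges almost everywhere along a subsequence. -/
theorem exists_subseq_tendsto_ae_of_tendsto_Lp {F : ℕ → Lp ℝ 2 P} {G : Lp ℝ 2 P}
    (h : Tendsto F atTop (𝓝 G)) :
    ∃ ns : ℕ → ℕ, StrictMono ns ∧ ∀ᵐ ω ∂P, Tendsto (fun i => F (ns i) ω) atTop (𝓝 (G ω)) :=
  (tendstoInMeasure_of_tendsto_Lp h).exists_seq_tendsto_ae

theorem coeFn_sum_smul_sub {B : ℝ → Ω → ℝ} (hB : ∀ s, MemLp (B s) 2 P) (s : Finset ℕ)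
    (k y z : ℕ → ℝ) :
    ∀ᵐ ω ∂P, (∑ i ∈ s, k i • ((hB (y i)).toLp (B (y i)) - (hB (z i)).toLp (B (z i))) : Lp ℝ 2 P) ω
      = ∑ i ∈ s, k i * (B (y i) ω - B (z i) ω) := by
  classical
  induction s using Finset.induction_on with
  | empty =>
    filter_upwards [Lp.coeFn_zero ℝ 2 P] with ω h
    simpa using h
  | insert i s hi ih =>
    rw [Finset.sum_insert hi]
    filter_upwards [ih, Lp.coeFn_add (k i • ((hB (y i)).toLp (B (y i)) - (hB (z i)).toLp (B (z i))))
        (∑ i ∈ s, k i • ((hB (y i)).toLp (B (y i)) - (hB (z i)).toLp (B (z i)))),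
      Lp.coeFn_smul (k i) ((hB (y i)).toLp (B (y i)) - (hB (z i)).toLp (B (z i))),
      Lp.coeFn_sub ((hB (y i)).toLp (B (y i))) ((hB (z i)).toLp (B (z i))),
      (hB (y i)).coeFn_toLp, (hB (z i)).coeFn_toLp] with ω h1 h2 h3 h4 h5 h6
    rw [h2, Pi.add_apply, h1, h3, Pi.smul_apply, h4, Pi.sub_apply, h5, h6, Finset.sum_insert hi,
      smul_eq_mul]

namespace IsFractionalBrownianMotion

variable {B : ℝ → Ω → ℝ} {H : ℝ}

theorem memLp (h : IsFractionalBrownianMotion B H P) (s : ℝ) : MemLp (B s) 2 P :=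
  (h.gaussian.hasGaussianLaw_eval s).memLp_two

/-- Fractional Brownian motion as a curve in `L²`. -/
noncomputable def curve (h : IsFractionalBrownianMotion B H P) (s : ℝ) : Lp ℝ 2 P :=
  (h.memLp s).toLp (B s)

theorem isFractionalCurve (h : IsFractionalBrownianMotion B H P) :
    IsFractionalCurve h.curve H := fun s t => by
  rw [L2.inner_def, ← h.covariance_eq s t]
  refine integral_congr_ae ?_
  filter_upwards [(h.memLp s).coeFn_toLp, (h.memLp t).coeFn_toLp] with ω h1 h2
  rw [curve, curve, h1, h2, real_inner_eq_mul]

/-- The mean, written as an inner product with `1`, commutes with the `L²`-valued integral. -/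
theorem inner_one_curve [IsProbabilityMeasure P] (h : IsFractionalBrownianMotion B H P) (s : ℝ) :
    inner ℝ ((memLp_const (1 : ℝ)).toLp (fun _ => (1 : ℝ)) : Lp ℝ 2 P) (h.curve s) = 0 := by
  rw [L2.inner_def, ← h.centered s]
  refine integral_congr_ae ?_
  filter_upwards [(h.memLp s).coeFn_toLp,
    (memLp_const (1 : ℝ) : MemLp (fun _ : Ω => (1 : ℝ)) 2 P).coeFn_toLp] with ω h1 h2
  rw [curve, h1, h2, real_inner_eq_mul, one_mul]

theorem integral_ouTransform [IsProbabilityMeasure P] (h : IsFractionalBrownianMotion B H P)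
    {l : ℝ} (hl : 0 < l) (t : ℝ) : ∫ ω, (ouTransform l h.curve t) ω ∂P = 0 := by
  have h1 : inner ℝ ((memLp_const (1 : ℝ)).toLp (fun _ => (1 : ℝ)) : Lp ℝ 2 P)
      (ouTransform l h.curve t) = 0 := by
    rw [ouTransform, ← integral_inner (h.isFractionalCurve.integrableOn_increment h.hurst_pos
      h.hurst_le_one hl t)]
    simp only [inner_smul_right, inner_sub_right, h.inner_one_curve, sub_zero, mul_zero,
      integral_zero]
  rw [← h1, L2.inner_def]
  refine integral_congr_ae ?_
  filter_upwards [(memLp_const (1 : ℝ) : MemLp (fun _ : Ω => (1 : ℝ)) 2 P).coeFn_toLp] with ω h2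
  rw [h2, real_inner_eq_mul, one_mul]

/-- The pathwise Ornstein–Uhlenbeck integral agrees with the Hilbert space valued one. -/
theorem ae_eq_ouTransform (h : IsFractionalBrownianMotion B H P) {l σ : ℝ} (hl : 0 < l)
    {t : ℝ} {x : Ω → ℝ} (hx : ∀ᵐ ω ∂P, IsOUOperatorValue l (fun s => σ * B s ω) t (x ω)) :
    x =ᵐ[P] ((σ * l) • ouTransform l h.curve t : Lp ℝ 2 P) := by
  have hc := h.isFractionalCurve
  have hpart (n : ℕ) : ∃ ns : ℕ → ℕ, StrictMono ns ∧ ∀ᵐ ω ∂P, Tendsto (fun j =>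
      ∑ i ∈ Finset.range (ns j + 1),
        Real.exp (-l * (t - (t - n + ((i + 1 : ℕ) : ℝ) * (n / ((ns j : ℕ) + 1))))) *
          (B (t - n + ((i + 1 : ℕ) : ℝ) * (n / ((ns j : ℕ) + 1))) ω
            - B (t - n + (i : ℝ) * (n / ((ns j : ℕ) + 1))) ω))
      atTop (𝓝 (ouPartial l h.curve t n ω)) := by
    obtain ⟨ns, hns, hlim⟩ := exists_subseq_tendsto_ae_of_tendsto_Lp
      (tendsto_sum_ouPartial (b := h.curve) h.hurst_pos hl n.cast_nonneg
        (fun s r => (hc.norm_sub h.hurst_pos s r).le) t)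
    refine ⟨ns, hns, ?_⟩
    have hsum := ae_all_iff.2 fun j : ℕ => coeFn_sum_smul_sub h.memLp (Finset.range (ns j + 1))
      (fun i => Real.exp (-l * (t - (t - n + ((i + 1 : ℕ) : ℝ) * (n / ((ns j : ℕ) + 1))))))
      (fun i => t - n + ((i + 1 : ℕ) : ℝ) * (n / ((ns j : ℕ) + 1)))
      (fun i => t - n + (i : ℝ) * (n / ((ns j : ℕ) + 1)))
    filter_upwards [hlim, hsum] with ω h1 h2
    exact h1.congr h2
  choose ns hns hlim using hpart
  -- Lower endpoints `t - n` with natural `n` keep the exceptional null sets countable in number.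
  obtain ⟨ks, hks, hk⟩ := exists_subseq_tendsto_ae_of_tendsto_Lp
    (hc.tendsto_ouPartial h.hurst_pos h.hurst_le_one hl t)
  filter_upwards [hx, ae_all_iff.2 hlim, hk, Lp.coeFn_smul (σ * l) (ouTransform l h.curve t),
    Lp.coeFn_smul l (ouTransform l h.curve t)] with ω h1 h2 h3 h4 h5
  obtain ⟨J, hJ, hJlim⟩ := h1
  -- Both sides are limits of the same sums along `ns n`.
  have hJeq (n : ℕ) : J (t - n) = σ * ouPartial l h.curve t n ω := by
    have e1 := (hJ (t - n) (sub_le_self t n.cast_nonneg)).tendsto_sum.comp (hns n).tendsto_atTop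
    refine tendsto_nhds_unique e1 (((h2 n).const_mul σ).congr fun j => ?_)
    simp only [Function.comp, Finset.mul_sum, sub_sub_cancel]
    exact Finset.sum_congr rfl fun i _ => by ring
  have hJx : Tendsto (fun j => J (t - (ks j : ℕ))) atTop (𝓝 (x ω)) := by
    refine hJlim.comp ?_
    exact tendsto_atBot_add_const_left _ t
      (tendsto_neg_atTop_atBot.comp (tendsto_natCast_atTop_atTop.comp hks.tendsto_atTop))
  simp_rw [hJeq] at hJx
  rw [tendsto_nhds_unique hJx (h3.const_mul σ), h4, h5]
  simp [mul_assoc]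

end IsFractionalBrownianMotion

end

/-! ### Mean, covariance and variance. -/

theorem mainTheorem4 {Ω : Type*} [MeasurableSpace Ω] (P : Measure Ω) [IsProbabilityMeasure P]
    (X : ℝ → Ω → ℝ) (lam σ H : ℝ) (hX : IsFOU X lam σ H P) (hH : 1 / 2 < H) :
    (∀ t, MemLp (X t) 2 P ∧ ∫ ω, X t ω ∂P = 0) ∧
    (∀ t, ∫ ω, X 0 ω * X t ω ∂P = σ ^ 2 * H * fH H (lam * |t|) / (2 * lam ^ (2 * H))) ∧
    (∀ t, Var[X t; P] = σ ^ 2 * Real.Gamma (2 * H + 1) / (2 * lam ^ (2 * H))) := by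
  obtain ⟨hl, -, B, hB, hBX⟩ := hX
  have hae (t : ℝ) := hB.ae_eq_ouTransform hl (hBX t)
  -- Measurability of `X t` is also inherited from its `L²` representative.
  have hL2 (t : ℝ) : MemLp (X t) 2 P := (memLp_congr_ae (hae t)).2 (Lp.memLp _)
  have hmean (t : ℝ) : ∫ ω, X t ω ∂P = 0 := by
    rw [integral_congr_ae ((hae t).trans (Lp.coeFn_smul _ _))]
    simp only [Pi.smul_apply, smul_eq_mul]
    rw [integral_const_mul, hB.integral_ouTransform hl, mul_zero]
  have hcov (s t : ℝ) : ∫ ω, X s ω * X t ω ∂P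
      = σ ^ 2 * (H * fH H (lam * |t - s|) / (2 * lam ^ (2 * H))) := by
    rw [← half_discountedPower_sub hl hH hB.hurst_le_one, ← hB.isFractionalCurve.inner_ouTransform
      hB.hurst_pos hB.hurst_le_one hl s t, ← mul_assoc, ← mul_pow, sq, mul_assoc,
      ← inner_smul_right, ← real_inner_smul_left, L2.inner_def]
    refine integral_congr_ae ?_
    filter_upwards [hae s, hae t] with ω h1 h2
    rw [h1, h2, real_inner_eq_mul]
  refine ⟨fun t => ⟨hL2 t, hmean t⟩, fun t => ?_, fun t => ?_⟩
  · rw [hcov, sub_zero]; ring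
  · rw [variance_eq_sub (hL2 t), hmean t]
    simp only [Pi.pow_apply, sq (X t _)]
    -- At lag zero `fH H 0 = 2 Γ(2H)`, and `2H Γ(2H) = Γ(2H + 1)`.
    rw [hcov, Real.Gamma_add_one (by linarith)]
    simp [fH, fH1, fH2]
    ring
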